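/- Let $f(x)=a_0x^n+a_1x^{n-1}+\cdots+a_n$ be a polynomial with real coefficients and $a_0>0$ which is stable, i.e. all of its complex zeros lie in the open left half-plane $\{z\in\mathbb{C}:\operatorname{Re} z<0\}$. Put $a_m=0$ for every integer $m<0$ and every integer $m>n$. Then for every even integer $M=2k$ with $1\le k\le\lfloor n/2\rfloor$ the infinite generalized Hurwitz matrix $$H_M(f)=\bigl(a_{Mj-i}\bigr)_{i,j=1}^{\infty}$$ is totally nonnegative, that is, all its minors (of every finite order $p$, with row indices $i_1<\cdots<i_p$ and column indices $j_1<\cdots<j_p$) are nonnegative. -/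

import Mathlib

open Polynomial

/-- A real polynomial is stable if all its complex zeros lie in the open left half-plane. -/
def IsStable (f : ℝ[X]) : Prop :=
  ∀ z : ℂ, aeval z f = 0 → z.re < 0

/-- For `f = a₀ xⁿ + a₁ xⁿ⁻¹ + ⋯ + aₙ` with `n = deg f`, the number `aₘ`, counted from the leading
coefficient, with the convention `aₘ = 0` for integers `m < 0` and `m > n`. -/
noncomputable def descCoeff (f : ℝ[X]) (m : ℤ) : ℝ :=
  if 0 ≤ m ∧ m ≤ (f.natDegree : ℤ) then f.coeff (f.natDegree - m.toNat) else 0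

/-- The generalized Hurwitz matrix `H_M(f) = (a_{Mj-i})`, with `i, j = 1, 2, 3, …`. -/
noncomputable def generalizedHurwitzMatrix (M : ℕ) (f : ℝ[X]) : Matrix ℕ+ ℕ+ ℝ :=
  Matrix.of fun i j => descCoeff f ((M : ℤ) * ((j : ℕ) : ℤ) - ((i : ℕ) : ℤ))

/-- A (possibly infinite) matrix is totally nonnegative if all its minors, of every finite order
`p`, with rows `i₁ < ⋯ < i_p` and columns `j₁ < ⋯ < j_p`, are nonnegative. -/
def IsTotallyNonnegative {m n : Type*} [Preorder m] [Preorder n] (A : Matrix m n ℝ) : Prop :=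
  ∀ (p : ℕ) (r : Fin p → m) (c : Fin p → n), StrictMono r → StrictMono c →
    0 ≤ (A.submatrix r c).det

/-!
Write `f = p + q` with `q = a₁ xⁿ⁻¹ + a₃ xⁿ⁻³ + ⋯`. One step of Routh's algorithm replaces `f` by
`g = f - (a₀ / a₁) x q`, of degree `n - 1`; comparing coefficients, every row of the Hurwitz matrix
of `f` is a combination, with nonnegative weights, of two consecutive rows of that of `g`. Such a
passage preserves total nonnegativity, and `g` is again stable, so induction on the degree reduces
the claim to constant polynomials.

Stability of `g` comes from a Julia-type inequality in the closed right half-plane. If `r` runs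
through the zeros of `f`, the quotient of `(-1)ⁿ f(-z)` by `f(z)` is the Blaschke product
`∏ (z + conj r) / (z - r)`, and adding the zeros one at a time gives
`Re z * |q(z)|² ≤ (a₁ / a₀) * Re (p(z) * conj (q(z)))`.
-/

open scoped ComplexConjugate

lemma det_smul_add_smul_rows {m ι R : Type*} [Fintype ι] [DecidableEq ι] [CommRing R]
    (B : Matrix m ι R) (u v : ι → R) (r s : ι → m) :
    Matrix.det (fun a => u a • B (r a) + v a • B (s a)) =
      ∑ t : Finset ι, (∏ a, t.piecewise u v a) * (B.submatrix (t.piecewise r s) id).det := by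
  refine (Matrix.detRowAlternating.toMultilinearMap.map_add_univ
    (fun a => u a • B (r a)) (fun a => v a • B (s a))).trans (Finset.sum_congr rfl fun t _ => ?_)
  have hpiecewise : (t.piecewise (fun a => u a • B (r a)) fun a => v a • B (s a)) =
      fun a => t.piecewise u v a • (B.submatrix (t.piecewise r s) id) a := by
    ext a j
    by_cases ha : a ∈ t <;> simp [ha]
  rw [hpiecewise]
  exact Matrix.detRowAlternating.toMultilinearMap.map_smul_univ _ _

namespace IsTotallyNonnegative

variable {m n : Type*}

lemma submatrix {m' n' : Type*} [Preorder m] [Preorder n] [Preorder m'] [Preorder n']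
    {A : Matrix m n ℝ} (hA : IsTotallyNonnegative A) {r : m' → m} {c : n' → n}
    (hr : StrictMono r) (hc : StrictMono c) : IsTotallyNonnegative (A.submatrix r c) :=
  fun p r' c' hr' hc' => hA p (r ∘ r') (c ∘ c') (hr.comp hr') (hc.comp hc')

lemma det_submatrix_nonneg_of_monotone [PartialOrder m] [Preorder n] {A : Matrix m n ℝ}
    (hA : IsTotallyNonnegative A) {p : ℕ} {r : Fin p → m} {c : Fin p → n} (hr : Monotone r)
    (hc : StrictMono c) : 0 ≤ (A.submatrix r c).det := by
  by_cases hinj : Function.Injective r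
  · exact hA p r c (hr.strictMono_of_injective hinj) hc
  · obtain ⟨a, b, hab, hne⟩ := Function.not_injective_iff.1 hinj
    refine (Matrix.det_zero_of_row_eq hne ?_).ge
    ext j
    simp only [Matrix.submatrix_apply, hab]

lemma of_row_eq_add_row_succ [PartialOrder m] [SuccOrder m] [Preorder n] {A B : Matrix m n ℝ}
    (hB : IsTotallyNonnegative B) {u v : m → ℝ} (hu : ∀ i, 0 ≤ u i) (hv : ∀ i, 0 ≤ v i)
    (hA : ∀ i, A i = u i • B i + v i • B (Order.succ i)) : IsTotallyNonnegative A := by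
  intro p r c hr hc
  have hdet : (A.submatrix r c).det = ∑ t : Finset (Fin p), (∏ a, t.piecewise (u ∘ r) (v ∘ r) a) *
      (B.submatrix (t.piecewise r (Order.succ ∘ r)) c).det := by
    refine Eq.trans ?_
      (det_smul_add_smul_rows (B.submatrix id c) (u ∘ r) (v ∘ r) r (Order.succ ∘ r))
    congr 1
    ext a j
    simp [hA]
  have hmono (t : Finset (Fin p)) : Monotone (t.piecewise r (Order.succ ∘ r)) := by
    intro a b hab
    rcases hab.eq_or_lt with rfl | hlt
    · rfl
    calc t.piecewise r (Order.succ ∘ r) a ≤ Order.succ (r a) := by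
          by_cases ha : a ∈ t <;> simp [ha, Order.le_succ]
      _ ≤ r b := Order.succ_le_of_lt (hr hlt)
      _ ≤ t.piecewise r (Order.succ ∘ r) b := by
          by_cases hb : b ∈ t <;> simp [hb, Order.le_succ]
  rw [hdet]
  refine Finset.sum_nonneg fun t _ => mul_nonneg (Finset.prod_nonneg fun a _ => ?_)
    (hB.det_submatrix_nonneg_of_monotone (hmono t) hc)
  by_cases ha : a ∈ t <;> simp [ha, hu, hv]

lemma diagonal [LinearOrder n] {d : n → ℝ} (hd : ∀ i, 0 ≤ d i) :
    IsTotallyNonnegative (Matrix.diagonal d) := by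
  intro p r c hr hc
  by_cases hrc : ∀ a, ∃ b, c b = r a
  · choose σ hσ using hrc
    have σ_mono : StrictMono σ := fun a b hab => hc.lt_iff_lt.1 (by simpa only [hσ] using hr hab)
    obtain rfl : c = r := funext fun a => by simpa [σ_mono.eq_id] using hσ a
    rw [Matrix.submatrix_diagonal _ _ hr.injective, Matrix.det_diagonal]
    exact Finset.prod_nonneg fun a _ => hd (c a)
  · push Not at hrc
    obtain ⟨a, ha⟩ := hrc
    exact (Matrix.det_eq_zero_of_row_eq_zero a fun b =>
      Matrix.diagonal_apply_ne d (ha b).symm).ge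

end IsTotallyNonnegative

section RightHalfPlane

lemma mul_add_sq_le_add_mul_add {R : Type*} [CommRing R] [LinearOrder R] [IsStrictOrderedRing R]
    {x a b s t U V : R} (hx : 0 ≤ x) (hs : 0 ≤ s) (ht : 0 ≤ t) (hU : 0 ≤ U) (hV : 0 ≤ V)
    (ha : x * a ^ 2 ≤ s * U) (hb : x * b ^ 2 ≤ t * V) :
    x * (a + b) ^ 2 ≤ (s + t) * (U + V) := by
  have cross : 2 * (x * a * b) ≤ s * V + t * U := by
    refine two_mul_le_add_of_sq_le_mul (by positivity) (by positivity) ?_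
    calc (x * a * b) ^ 2 = (x * a ^ 2) * (x * b ^ 2) := by ring
      _ ≤ (s * U) * (t * V) := by gcongr
      _ = s * V * (t * U) := by ring
  linear_combination ha + hb + cross

lemma sq_norm_sub_eq_sq_norm_add_conj_add (z r : ℂ) :
    ‖z - r‖ ^ 2 = ‖z + conj r‖ ^ 2 + 4 * (z.re * -r.re) := by
  simp only [Complex.sq_norm, Complex.normSq_apply, Complex.sub_re, Complex.sub_im,
    Complex.add_re, Complex.add_im, Complex.conj_re, Complex.conj_im]
  ring

lemma norm_sub_mul_sub_add_conj_mul_le (z : ℂ) {r : ℂ} (hr : r.re ≤ 0) (F G : ℂ) :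
    ‖(z - r) * F - (z + conj r) * G‖ ≤ ‖z - r‖ * ‖F - G‖ + 2 * -r.re * ‖G‖ := by
  have hadd : r + conj r = 2 * (r.re : ℂ) := mod_cast Complex.add_conj r
  have hsplit : (z - r) * F - (z + conj r) * G =
      (z - r) * (F - G) + ((2 * -r.re : ℝ) : ℂ) * G := by
    push_cast
    linear_combination -G * hadd
  rw [hsplit]
  refine (norm_add_le _ _).trans_eq ?_
  rw [norm_mul, norm_mul, Complex.norm_real, Real.norm_of_nonneg (by linarith)]

variable {z : ℂ} {S : Multiset ℂ}

lemma norm_prod_add_conj_le_norm_prod_sub (hz : 0 ≤ z.re) (hS : ∀ r ∈ S, r.re ≤ 0) :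
    ‖(S.map fun r => z + conj r).prod‖ ≤ ‖(S.map fun r => z - r).prod‖ := by
  induction S using Multiset.induction with
  | empty => simp
  | cons r S ih =>
    rw [Multiset.forall_mem_cons] at hS
    have hfactor : ‖z + conj r‖ ≤ ‖z - r‖ := by
      rw [← sq_le_sq₀ (norm_nonneg _) (norm_nonneg _), sq_norm_sub_eq_sq_norm_add_conj_add]
      linarith [mul_nonneg hz (neg_nonneg.2 hS.1)]
    simp only [Multiset.map_cons, Multiset.prod_cons, norm_mul]
    gcongr
    exact ih hS.2

lemma re_mul_sq_norm_prod_sub_sub_prod_add_conj_le (hz : 0 ≤ z.re) (hS : ∀ r ∈ S, r.re ≤ 0) :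
    z.re * ‖(S.map fun r => z - r).prod - (S.map fun r => z + conj r).prod‖ ^ 2 ≤
      (S.map fun r => -r.re).sum * (‖(S.map fun r => z - r).prod‖ ^ 2 -
        ‖(S.map fun r => z + conj r).prod‖ ^ 2) := by
  induction S using Multiset.induction with
  | empty => simp
  | cons r S ih =>
    rw [Multiset.forall_mem_cons] at hS
    have hFG := norm_prod_add_conj_le_norm_prod_sub hz hS.2
    have hr : 0 ≤ -r.re := neg_nonneg.2 hS.1
    have hσ : 0 ≤ (S.map fun r => -r.re).sum :=
      Multiset.sum_nonneg (by simpa using hS.2)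
    specialize ih hS.2
    simp only [Multiset.map_cons, Multiset.prod_cons, Multiset.sum_cons]
    set F := (S.map fun r => z - r).prod
    set G := (S.map fun r => z + conj r).prod
    calc z.re * ‖(z - r) * F - (z + conj r) * G‖ ^ 2
        ≤ z.re * (‖z - r‖ * ‖F - G‖ + 2 * -r.re * ‖G‖) ^ 2 := by
          gcongr
          exact norm_sub_mul_sub_add_conj_mul_le z hS.1 F G
      _ ≤ ((S.map fun r => -r.re).sum + -r.re) *
            (‖z - r‖ ^ 2 * (‖F‖ ^ 2 - ‖G‖ ^ 2) + 4 * (z.re * -r.re) * ‖G‖ ^ 2) := by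
          have hU : 0 ≤ ‖F‖ ^ 2 - ‖G‖ ^ 2 := sub_nonneg.2 (by gcongr)
          refine mul_add_sq_le_add_mul_add hz hσ hr (by positivity) (by positivity) ?_
            (le_of_eq (by ring))
          linear_combination ‖z - r‖ ^ 2 * ih
      _ = (-r.re + (S.map fun r => -r.re).sum) *
            (‖(z - r) * F‖ ^ 2 - ‖(z + conj r) * G‖ ^ 2) := by
          rw [norm_mul, norm_mul, mul_pow, mul_pow]
          linear_combination ((S.map fun r => -r.re).sum + -r.re) * -‖G‖ ^ 2 *
            sq_norm_sub_eq_sq_norm_add_conj_add z r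

end RightHalfPlane

/-- The reflection `(-1)ⁿ f(-x)` of a polynomial `f` of degree `n`, whose zeros are the negatives of
those of `f`; the sign makes its leading coefficient that of `f`. -/
noncomputable def reflection {R : Type*} [CommRing R] (f : R[X]) : R[X] :=
  C ((-1) ^ f.natDegree) * f.comp (-X)

/-- The part `a₁ xⁿ⁻¹ + a₃ xⁿ⁻³ + ⋯` of `f = a₀ xⁿ + a₁ xⁿ⁻¹ + ⋯ + aₙ`, obtained as half the
difference of `f` and its reflection. -/
noncomputable def subleadingPart {K : Type*} [Field K] (f : K[X]) : K[X] :=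
  C (1 / 2) * (f - reflection f)

/-- One step of Routh's algorithm, which cancels the leading term of `f` against `x` times its
subleading part. -/
noncomputable def routhStep {K : Type*} [Field K] (f : K[X]) : K[X] :=
  f - C (f.leadingCoeff / f.nextCoeff) * (X * subleadingPart f)

section Coefficients

lemma coeff_reflection {R : Type*} [CommRing R] (f : R[X]) (l : ℕ) :
    (reflection f).coeff l = (-1) ^ (f.natDegree + l) * f.coeff l := by
  have h := comp_C_mul_X_coeff (p := f) (r := (-1 : R)) (n := l)
  rw [C_neg, C_1, neg_one_mul] at h
  rw [reflection, coeff_C_mul, h, pow_add]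
  ring

variable {K : Type*} [Field K] [NeZero (2 : K)] {f : K[X]}

lemma coeff_subleadingPart (f : K[X]) (l : ℕ) :
    (subleadingPart f).coeff l = if Odd (f.natDegree + l) then f.coeff l else 0 := by
  rw [subleadingPart, coeff_C_mul, coeff_sub, coeff_reflection]
  split_ifs with hl
  · rw [hl.neg_one_pow]
    field
  · rw [(Nat.not_odd_iff_even.1 hl).neg_one_pow]
    ring

lemma coeff_routhStep_of_odd {l : ℕ} (hl : Odd (f.natDegree + l)) :
    (routhStep f).coeff l = f.coeff l := by
  cases l with
  | zero => simp [routhStep]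
  | succ l =>
    have hl' : ¬Odd (f.natDegree + l) := by grind
    simp [routhStep, coeff_subleadingPart, hl']

lemma coeff_routhStep_succ_of_odd {l : ℕ} (hl : Odd (f.natDegree + l)) :
    (routhStep f).coeff (l + 1) =
      f.coeff (l + 1) - f.leadingCoeff / f.nextCoeff * f.coeff l := by
  simp [routhStep, coeff_subleadingPart, hl]

lemma coeff_routhStep_natDegree_sub_one (h : f.nextCoeff ≠ 0) :
    (routhStep f).coeff (f.natDegree - 1) = f.nextCoeff := by
  have hn := natDegree_pos_of_nextCoeff_ne_zero h
  rw [coeff_routhStep_of_odd (by grind), nextCoeff_of_natDegree_pos hn]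

lemma coeff_routhStep_eq_zero (h : f.nextCoeff ≠ 0) {l : ℕ} (hl : f.natDegree ≤ l) :
    (routhStep f).coeff l = 0 := by
  have hn := natDegree_pos_of_nextCoeff_ne_zero h
  rcases Nat.even_or_odd (f.natDegree + l) with heven | hodd
  · obtain ⟨l, rfl⟩ := Nat.exists_eq_add_one_of_ne_zero (hn.trans_le hl).ne'
    rw [coeff_routhStep_succ_of_odd (by grind)]
    rcases hl.eq_or_lt with heq | hlt
    · have hnext : f.nextCoeff = f.coeff l := by
        rw [nextCoeff_of_natDegree_pos hn, heq, Nat.add_sub_cancel]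
      rw [← hnext, ← heq, coeff_natDegree, div_mul_cancel₀ _ h, sub_self]
    · have hlt' : f.natDegree < l := by grind
      simp [coeff_eq_zero_of_natDegree_lt hlt, coeff_eq_zero_of_natDegree_lt hlt']
  · rw [coeff_routhStep_of_odd hodd, coeff_eq_zero_of_natDegree_lt (by grind)]

lemma natDegree_routhStep_add_one (h : f.nextCoeff ≠ 0) :
    (routhStep f).natDegree + 1 = f.natDegree := by
  have hn := natDegree_pos_of_nextCoeff_ne_zero h
  have hle : (routhStep f).natDegree ≤ f.natDegree - 1 :=
    natDegree_le_iff_coeff_eq_zero.2 fun l hl => coeff_routhStep_eq_zero h (by omega)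
  rw [natDegree_eq_of_le_of_coeff_ne_zero hle (by rwa [coeff_routhStep_natDegree_sub_one h])]
  omega

lemma leadingCoeff_routhStep (h : f.nextCoeff ≠ 0) :
    (routhStep f).leadingCoeff = f.nextCoeff := by
  rw [← coeff_routhStep_natDegree_sub_one h, leadingCoeff, ← natDegree_routhStep_add_one h,
    Nat.add_sub_cancel]

end Coefficients

section DescendingCoefficients

variable {f : ℝ[X]}

lemma descCoeff_natDegree_sub (f : ℝ[X]) (l : ℕ) :
    descCoeff f (f.natDegree - l) = f.coeff l := by
  rw [descCoeff]
  split_ifs with hl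
  · congr 1
    omega
  · rw [coeff_eq_zero_of_natDegree_lt (by omega)]

lemma descCoeff_of_natDegree_lt {m : ℤ} (h : (f.natDegree : ℤ) < m) : descCoeff f m = 0 :=
  if_neg (by omega)

lemma descCoeff_routhStep_of_even (h : f.nextCoeff ≠ 0) {m : ℤ} (hm : Even m) :
    descCoeff (routhStep f) m = descCoeff f (m + 1) := by
  have hdeg := natDegree_routhStep_add_one h
  rcases lt_or_ge ((routhStep f).natDegree : ℤ) m with hlt | hle
  · rw [descCoeff_of_natDegree_lt hlt, descCoeff_of_natDegree_lt (by omega)]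
  obtain ⟨l, rfl⟩ : ∃ l : ℕ, m = (routhStep f).natDegree - l :=
    ⟨((routhStep f).natDegree - m).toNat, by omega⟩
  have hm' : ((routhStep f).natDegree - l + 1 : ℤ) = f.natDegree - l := by omega
  rw [hm', descCoeff_natDegree_sub, descCoeff_natDegree_sub, coeff_routhStep_of_odd (by grind)]

lemma descCoeff_routhStep_of_odd (h : f.nextCoeff ≠ 0) {m : ℤ} (hm : Odd m) :
    descCoeff (routhStep f) m =
      descCoeff f (m + 1) - f.leadingCoeff / f.nextCoeff * descCoeff f (m + 2) := by
  have hdeg := natDegree_routhStep_add_one h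
  rcases lt_or_ge ((routhStep f).natDegree : ℤ) m with hlt | hle
  · simp [descCoeff_of_natDegree_lt hlt, descCoeff_of_natDegree_lt (f := f) (m := m + 1) (by omega),
      descCoeff_of_natDegree_lt (f := f) (m := m + 2) (by omega)]
  obtain ⟨l, rfl⟩ : ∃ l : ℕ, m = (routhStep f).natDegree - l :=
    ⟨((routhStep f).natDegree - m).toNat, by omega⟩
  have hm₁ : ((routhStep f).natDegree - l + 1 : ℤ) = f.natDegree - l := by omega
  rw [hm₁, descCoeff_natDegree_sub, descCoeff_natDegree_sub]
  cases l with
  | zero => rw [descCoeff_of_natDegree_lt (by omega)]; simp [routhStep]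
  | succ l =>
    have hm₂ : ((routhStep f).natDegree - (l + 1 : ℕ) + 2 : ℤ) = f.natDegree - l := by omega
    rw [hm₂, descCoeff_natDegree_sub, coeff_routhStep_succ_of_odd (by grind)]

end DescendingCoefficients

section HurwitzMatrix

lemma generalizedHurwitzMatrix_of_natDegree_eq_zero (M : ℕ+) {f : ℝ[X]} (hf : f.natDegree = 0) :
    generalizedHurwitzMatrix M f =
      (Matrix.diagonal fun _ : ℕ+ => f.leadingCoeff).submatrix id (M * ·) := by
  ext i j
  simp only [generalizedHurwitzMatrix, Matrix.of_apply, Matrix.submatrix_apply, id,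
    Matrix.diagonal_apply, descCoeff, leadingCoeff, hf, ← PNat.coe_inj, PNat.mul_coe]
  push_cast
  grind

lemma generalizedHurwitzMatrix_row_of_even {M : ℕ} (hM : Even M) {f : ℝ[X]}
    (h : f.nextCoeff ≠ 0) (i : ℕ+) :
    generalizedHurwitzMatrix M f i =
      (if Even (i : ℕ) then f.leadingCoeff / f.nextCoeff else 0) •
          generalizedHurwitzMatrix M (routhStep f) i +
        (1 : ℝ) • generalizedHurwitzMatrix M (routhStep f) (Order.succ i) := by
  ext j
  have hMj : Even ((M : ℤ) * (j : ℕ)) := (mod_cast hM : Even (M : ℤ)).mul_right _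
  simp only [generalizedHurwitzMatrix, Matrix.of_apply, Pi.add_apply, Pi.smul_apply, smul_eq_mul,
    one_mul, Order.succ_eq_add_one, PNat.add_coe, PNat.one_coe]
  push_cast
  rw [← sub_sub]
  split_ifs with hi
  · rw [descCoeff_routhStep_of_even h (by grind), descCoeff_routhStep_of_odd h (by grind)]
    ring_nf
  · rw [descCoeff_routhStep_of_even h (m := _ - 1) (by grind)]
    ring_nf

end HurwitzMatrix

section Roots

lemma map_aroots_of_algHom {K L : Type*} [CommRing K] [Field L] [IsAlgClosed L] [Algebra K L]
    (f : K[X]) (σ : L →ₐ[K] L) : (f.aroots L).map σ = f.aroots L := by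
  have h := (IsAlgClosed.splits (f.map (algebraMap K L))).roots_map (σ : L →+* L)
  rw [map_map, σ.comp_algebraMap] at h
  exact h.symm

lemma nextCoeff_div_leadingCoeff_eq_sum_aroots {f : ℝ[X]} (hf : f ≠ 0) :
    f.nextCoeff / f.leadingCoeff = ((f.aroots ℂ).map fun r => -r.re).sum := by
  have h :=
    (IsAlgClosed.splits (f.map (algebraMap ℝ ℂ))).nextCoeff_eq_neg_sum_roots_mul_leadingCoeff
  have hre : (f.aroots ℂ).sum.re = ((f.aroots ℂ).map fun r => r.re).sum :=
    map_multiset_sum Complex.reAddGroupHom _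
  rw [nextCoeff_map_eq, leadingCoeff_map] at h
  rw [div_eq_iff (leadingCoeff_ne_zero.2 hf), mul_comm, Multiset.sum_map_neg, ← hre]
  simpa [aroots] using congrArg Complex.re h

lemma aeval_reflection_eq_prod_aroots {K L : Type*} [Field K] [Field L] [IsAlgClosed L]
    [Algebra K L] (f : K[X]) (z : L) :
    aeval z (reflection f) =
      algebraMap K L f.leadingCoeff * ((f.aroots L).map fun r => z + r).prod := by
  have hneg : aeval (-z) f = algebraMap K L f.leadingCoeff *
      ((-1) ^ f.natDegree * ((f.aroots L).map fun r => z + r).prod) := by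
    rw [(IsAlgClosed.splits _).aeval_eq_prod_aroots,
      ← IsAlgClosed.card_aroots_eq_natDegree (B := L), ← Multiset.card_map (fun r => z + r),
      ← Multiset.prod_map_neg, Multiset.map_map]
    simp only [Function.comp_def, neg_add']
  calc aeval z (reflection f) = (-1) ^ f.natDegree * aeval (-z) f := by
        simp [reflection, aeval_comp]
    _ = ((-1) * (-1)) ^ f.natDegree *
          (algebraMap K L f.leadingCoeff * ((f.aroots L).map fun r => z + r).prod) := by
        rw [hneg, mul_pow]
        ring
    _ = algebraMap K L f.leadingCoeff * ((f.aroots L).map fun r => z + r).prod := by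
        rw [neg_mul_neg, one_mul, one_pow, one_mul]

lemma aeval_reflection_eq_prod_aroots_conj (f : ℝ[X]) (z : ℂ) :
    aeval z (reflection f) =
      f.leadingCoeff * ((f.aroots ℂ).map fun r => z + conj r).prod := by
  have hconj : (f.aroots ℂ).map conj = f.aroots ℂ :=
    map_aroots_of_algHom f Complex.conjAe.toAlgHom
  rw [aeval_reflection_eq_prod_aroots, Complex.coe_algebraMap]
  conv_lhs => rw [← hconj, Multiset.map_map]
  rfl

end Roots

namespace IsStable

variable {f : ℝ[X]}

lemma ne_zero (hf : IsStable f) : f ≠ 0 := by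
  rintro rfl
  exact (hf 1 (by simp)).not_gt (by simp)

lemma re_lt_zero_of_mem_aroots (hf : IsStable f) {r : ℂ} (hr : r ∈ f.aroots ℂ) : r.re < 0 :=
  hf r (mem_aroots.1 hr).2

lemma nextCoeff_div_leadingCoeff_pos (hf : IsStable f) (hn : f.natDegree ≠ 0) :
    0 < f.nextCoeff / f.leadingCoeff := by
  rw [nextCoeff_div_leadingCoeff_eq_sum_aroots hf.ne_zero]
  have hne : f.aroots ℂ ≠ ∅ := by
    rwa [Multiset.empty_eq_zero, ← Multiset.card_eq_zero.ne, IsAlgClosed.card_aroots_eq_natDegree]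
  simpa using Multiset.sum_lt_sum_of_nonempty (f := fun _ => (0 : ℝ)) hne
    fun r hr => neg_pos.2 (hf.re_lt_zero_of_mem_aroots hr)

lemma re_mul_sq_norm_sub_reflection_le (hf : IsStable f) {z : ℂ} (hz : 0 ≤ z.re) :
    z.re * ‖aeval z f - aeval z (reflection f)‖ ^ 2 ≤ f.nextCoeff / f.leadingCoeff *
      (‖aeval z f‖ ^ 2 - ‖aeval z (reflection f)‖ ^ 2) := by
  have julia := re_mul_sq_norm_prod_sub_sub_prod_add_conj_le hz
    fun r hr => (hf.re_lt_zero_of_mem_aroots hr).le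
  rw [nextCoeff_div_leadingCoeff_eq_sum_aroots hf.ne_zero, aeval_reflection_eq_prod_aroots_conj,
    (IsAlgClosed.splits _).aeval_eq_prod_aroots, Complex.coe_algebraMap, ← mul_sub]
  simp only [norm_mul, mul_pow]
  linear_combination ‖(f.leadingCoeff : ℂ)‖ ^ 2 * julia

lemma add_mul_sq_norm_subleadingPart_le (hf : IsStable f) {z : ℂ} (hz : 0 ≤ z.re) :
    (z.re + f.nextCoeff / f.leadingCoeff) * ‖aeval z (subleadingPart f)‖ ^ 2 ≤
      f.nextCoeff / f.leadingCoeff * (aeval z f * conj (aeval z (subleadingPart f))).re := by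
  have julia := hf.re_mul_sq_norm_sub_reflection_le hz
  set F := aeval z f
  set q := aeval z (subleadingPart f) with hq
  have hG : aeval z (reflection f) = F - 2 * q := by
    simp [hq, subleadingPart, F]
  have normSq_G : ‖F - 2 * q‖ ^ 2 = ‖F‖ ^ 2 + 4 * ‖q‖ ^ 2 - 4 * (F * conj q).re := by
    have hcross : (F * conj (2 * q)).re = 2 * (F * conj q).re := by
      rw [map_mul, Complex.conj_ofNat, mul_left_comm, ← Complex.ofReal_ofNat, Complex.re_ofReal_mul]
    simp only [Complex.sq_norm, Complex.normSq_sub, hcross, Complex.normSq_mul,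
      Complex.normSq_ofNat]
    ring
  rw [hG, normSq_G, sub_sub_cancel, norm_mul, mul_pow, Complex.norm_ofNat] at julia
  linear_combination julia / 4

lemma routhStep (hf : IsStable f) (hn : f.natDegree ≠ 0) : IsStable (routhStep f) := by
  intro z hz
  by_contra! hre
  have hσ := hf.nextCoeff_div_leadingCoeff_pos hn
  have hbound := hf.add_mul_sq_norm_subleadingPart_le hre
  set q := aeval z (subleadingPart f)
  set σ := f.nextCoeff / f.leadingCoeff
  have hF : σ * aeval z f = z * q := by
    have hinv : f.leadingCoeff / f.nextCoeff = σ⁻¹ := (inv_div _ _).symm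
    have hσ' : (σ : ℂ) ≠ 0 := mod_cast hσ.ne'
    simp only [_root_.routhStep, hinv, map_sub, map_mul, aeval_C, aeval_X, Complex.coe_algebraMap,
      Complex.ofReal_inv] at hz
    rw [sub_eq_zero.1 hz, mul_inv_cancel_left₀ hσ']
  have hF' : σ * (aeval z f * conj q).re = z.re * ‖q‖ ^ 2 := by
    rw [← Complex.re_ofReal_mul, ← mul_assoc, hF, mul_assoc, Complex.mul_conj',
      ← Complex.ofReal_pow, Complex.re_mul_ofReal]
  have hq : q = 0 := by
    have hle : σ * ‖q‖ ^ 2 ≤ 0 := by linarith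
    simpa using (nonpos_of_mul_nonpos_right hle hσ).antisymm (sq_nonneg _)
  have hf0 : aeval z f = 0 := by simpa [hq, hσ.ne'] using hF
  exact hre.not_gt (hf z hf0)

end IsStable

theorem mainTheorem5_general (f : ℝ[X]) (ha₀ : 0 < f.leadingCoeff) (hf : IsStable f) (k : ℕ+) :
    IsTotallyNonnegative (generalizedHurwitzMatrix (2 * k) f) := by
  obtain ⟨n, hn⟩ : ∃ n, f.natDegree = n := ⟨_, rfl⟩
  induction n generalizing f with
  | zero =>
    have hdiag := generalizedHurwitzMatrix_of_natDegree_eq_zero (2 * k) hn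
    rw [PNat.mul_coe, PNat.val_ofNat] at hdiag
    rw [hdiag]
    exact (IsTotallyNonnegative.diagonal fun _ => ha₀.le).submatrix strictMono_id
      fun _ _ hab => mul_lt_mul_right hab (2 * k)
  | succ n ih =>
    have hn₀ : f.natDegree ≠ 0 := by omega
    have hnext : 0 < f.nextCoeff :=
      (div_pos_iff_of_pos_right ha₀).1 (hf.nextCoeff_div_leadingCoeff_pos hn₀)
    have hdeg := natDegree_routhStep_add_one hnext.ne'
    have hlead := leadingCoeff_routhStep hnext.ne'
    have hstep := ih (routhStep f) (hlead ▸ hnext) (hf.routhStep hn₀) (by omega)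
    refine hstep.of_row_eq_add_row_succ (fun i => ?_) (fun _ => zero_le_one)
      (generalizedHurwitzMatrix_row_of_even (even_two_mul _) hnext.ne')
    split_ifs
    exacts [(div_pos ha₀ hnext).le, le_rfl]

theorem mainTheorem5 (f : ℝ[X]) (ha₀ : 0 < f.leadingCoeff) (hf : IsStable f)
    (k : ℕ) (hk₁ : 1 ≤ k) (hk₂ : k ≤ f.natDegree / 2) :
    IsTotallyNonnegative (generalizedHurwitzMatrix (2 * k) f) :=
  mainTheorem5_general f ha₀ hf ⟨k, hk₁⟩
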